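/- **Theorem (Berk's theorem via curvature).** Let $\mathcal X$ be a finite sample space and $P_0$ a probability distribution on $\mathcal X$. Let $\Theta\subseteq\mathbb R^d$ be measurable and let $\theta\mapsto P_\theta$ be a continuous map from $\Theta$ to the strictly positive probability vectors on $\mathcal X$; $P_0$ need not belong to the model $\{P_\theta:\theta\in\Theta\}$. Write $D(P\|Q)=\sum_x P(x)\log\frac{P(x)}{Q(x)}$. Assume: * $\theta_0\in\operatorname{int}\Theta$ minimizes $\theta\mapsto D(P_0\|P_\theta)$ over $\Theta$, and the minimum is well separated: $\inf_{\theta\in\Theta,\ \|\theta-\theta_0\|\ge\delta}D(P_0\|P_\theta)>D(P_0\|P_{\theta_0})$ for every $\delta>0$ (with $\inf\emptyset=+\infty$); * $\theta\mapsto P_\theta$ is twice continuously differentiable near $\theta_0$, with linearly independent partial derivatives at $\theta_0$, and the Hessian of $\theta\mapsto D(P_0\|P_\theta)$ at $\theta_0$ is positive definite; * the prior $\pi$ is a probability measure on $\Theta$ that has, near $\theta_0$, a positive continuous Lebesgue density. Let $T_{\theta_0}=\operatorname{span}\{\partial_1P_{\theta_0},\dots,\partial_dP_{\theta_0}\}$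 be the tangent space of the model at $P_{\theta_0}$, let the columns of $V$ be a basis of $T_{\theta_0}$, and let $$H^*_{\theta_0}=V^\top\operatorname{diag}(1/P_{\theta_0})\,V$$ be the information metric (the Kullback–Leibler Hessian restricted to $T_{\theta_0}$) in this basis. (For an orthonormal basis this is the compression of $\operatorname{diag}(1/P_{\theta_0})$ to $T_{\theta_0}$; for the basis of partial derivatives it is the Fisher information matrix.) Let $X_1,X_2,\dots$ be i.i.d. from $P_0$ and let $\Pr(\,\cdot\mid X_{1:n})$ be the posterior distribution, $\Pr(d\theta\mid X_{1:n})\propto\prod_{i=1}^nP_\theta(X_i)\,\pi(d\theta)$. 1. For every $R>0$ there are constants $c,C>0$, not depending on $n$, $\varepsilon$ or the data, such that for all $n\ge 0$ and all $0<\varepsilon\le R$ the bound $$\Pr\big(\|\theta-\theta_0\|_2>\varepsilon\mid X_{1:n}\big)\le C\exp\{-c\,n\,\lambda_{\min}(H^*_{\theta_0})\,\varepsilon^2\}$$ holds outside an event of $P_0$-probability at most $C\exp\{-c\,n\,\lambda_{\min}(H^*_{\theta_0})\,\varepsilon^2\}$. If $\Theta$ is bounded, one pair $c,C$ serves for all $\varepsilon>0$.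 2. $\|\theta-\theta_0\|_2=O_p\Big(\sqrt{\frac{\log n}{n\,\lambda_{\min}(H^*_{\theta_0})}}\Big)$ under the joint law of $(X_{1:n},\theta)$ in which $X_{1:n}$ is i.i.d. from $P_0$ and, given $X_{1:n}$, $\theta$ is drawn from the posterior: for every $\delta>0$ there is $M$ such that, for all large $n$, this law gives probability at most $\delta$ to $\|\theta-\theta_0\|_2>M\sqrt{\log n/(n\,\lambda_{\min}(H^*_{\theta_0}))}$. -/

import Mathlib

open MeasureTheory Filter Topology Set

noncomputable section

namespace BerkCurvature

/-- The open probability simplex over a finite sample space. -/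
def openSimplex (𝒳 : Type*) [Fintype 𝒳] : Set (𝒳 → ℝ) :=
  {p | (∀ x, 0 < p x) ∧ ∑ x, p x = 1}

/-- Kullback-Leibler divergence `D(P‖q) = ∑ x, P(x) log (P(x) / q(x))` of a distribution `P` on a
finite space from a strictly positive probability vector `q` (with `0 log 0 = 0`). -/
def kl {𝒳 : Type*} [Fintype 𝒳] [MeasurableSpace 𝒳] (P : Measure 𝒳) (q : 𝒳 → ℝ) : ℝ :=
  ∑ x, P.real {x} * Real.log (P.real {x} / q x)

/-- `θ₀` is the KL-pseudo-true parameter: it minimizes `θ ↦ D(P₀‖p θ)` over `Θ`, and the minimum is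
well separated (automatic for a unique minimizer when `Θ` is compact and `p` is continuous). -/
def IsPseudoTrue {𝒳 : Type*} [Fintype 𝒳] [MeasurableSpace 𝒳] {d : ℕ}
    (P₀ : Measure 𝒳) (p : EuclideanSpace ℝ (Fin d) → 𝒳 → ℝ)
    (Θ : Set (EuclideanSpace ℝ (Fin d))) (θ₀ : EuclideanSpace ℝ (Fin d)) : Prop :=
  θ₀ ∈ Θ ∧ (∀ θ ∈ Θ, kl P₀ (p θ₀) ≤ kl P₀ (p θ)) ∧
    ∀ δ > 0, ∃ η > 0, ∀ θ ∈ Θ, δ ≤ ‖θ - θ₀‖ → kl P₀ (p θ₀) + η ≤ kl P₀ (p θ)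

/-- The tangent space at `p θ₀` of the manifold `{p θ}`: the span of the partial derivatives. -/
def tangentSpace {𝒳 : Type*} [Fintype 𝒳] {d : ℕ}
    (p : EuclideanSpace ℝ (Fin d) → 𝒳 → ℝ) (θ₀ : EuclideanSpace ℝ (Fin d)) :
    Submodule ℝ (𝒳 → ℝ) :=
  (fderiv ℝ p θ₀).range

/-- The columns of `V` form a basis of the tangent space of `{p θ}` at `p θ₀`. As `V` has `d`
columns, such a `V` exists iff `θ ↦ p θ` is an immersion at `θ₀`. -/
def IsTangentBasis {𝒳 : Type*} [Fintype 𝒳] {d : ℕ}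
    (p : EuclideanSpace ℝ (Fin d) → 𝒳 → ℝ) (θ₀ : EuclideanSpace ℝ (Fin d))
    (V : Matrix 𝒳 (Fin d) ℝ) : Prop :=
  LinearIndependent ℝ V.col ∧ Submodule.span ℝ (Set.range V.col) = tangentSpace p θ₀

/-- The information-metric Hessian `Vᵀ diag(1/q) V`: the restriction of the ambient Hessian
`diag(1/q)` of the Kullback-Leibler divergence (the Fisher-Rao metric) to the span of the columns
of `V`. If the columns are the partial derivatives of `p` at `θ₀` and `q = p θ₀`, this is the Fisher
information matrix; if they are orthonormal, it is the compression of `diag(1/q)` to their span. -/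
def infoHessian {𝒳 : Type*} [Fintype 𝒳] [DecidableEq 𝒳] {d : ℕ}
    (q : 𝒳 → ℝ) (V : Matrix 𝒳 (Fin d) ℝ) : Matrix (Fin d) (Fin d) ℝ :=
  V.transpose * Matrix.diagonal (fun x => 1 / q x) * V

/-- The smallest eigenvalue of a real symmetric matrix. -/
def lambdaMin {d : ℕ} (H : Matrix (Fin d) (Fin d) ℝ) : ℝ :=
  sInf (spectrum ℝ H)

/-- Near `θ₀`, the prior `π` has a positive continuous density with respect to Lebesgue measure. -/
def HasPosContDensityNear {d : ℕ} (π : Measure (EuclideanSpace ℝ (Fin d)))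
    (θ₀ : EuclideanSpace ℝ (Fin d)) : Prop :=
  ∃ U : Set (EuclideanSpace ℝ (Fin d)), IsOpen U ∧ θ₀ ∈ U ∧
    ∃ f : EuclideanSpace ℝ (Fin d) → ℝ, ContinuousOn f U ∧ (∀ θ ∈ U, 0 < f θ) ∧
      π.restrict U = (volume.restrict U).withDensity (fun θ => ENNReal.ofReal (f θ))

/-- The likelihood `∏ i, p θ (x i)` of a sample `x`. -/
def likelihood {𝒳 : Type*} {d n : ℕ} (p : EuclideanSpace ℝ (Fin d) → 𝒳 → ℝ)
    (x : Fin n → 𝒳) (θ : EuclideanSpace ℝ (Fin d)) : ℝ :=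
  ∏ i, p θ (x i)

/-- The posterior distribution given the sample `x`, by Bayes' formula: proportional to
likelihood times prior. -/
def posterior {𝒳 : Type*} {d n : ℕ} (π : Measure (EuclideanSpace ℝ (Fin d)))
    (p : EuclideanSpace ℝ (Fin d) → 𝒳 → ℝ) (x : Fin n → 𝒳) :
    Measure (EuclideanSpace ℝ (Fin d)) :=
  (∫⁻ θ, ENNReal.ofReal (likelihood p x θ) ∂π)⁻¹ •
    π.withDensity (fun θ => ENNReal.ofReal (likelihood p x θ))

/-- The law of an i.i.d. sample of size `n` from `P₀`. -/
def sampleLaw {𝒳 : Type*} [MeasurableSpace 𝒳] (P₀ : Measure 𝒳) (n : ℕ) :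
    Measure (Fin n → 𝒳) :=
  Measure.pi (fun _ => P₀)

/-- Exponential posterior tails at rate `lam`, for radii `ε ∈ S`: with constants `c, C > 0` not
depending on `n`, `ε` or the data, the bound `Pr(‖θ - θ₀‖ > ε | X₁, …, Xₙ) ≤ C exp(-c n lam ε²)`
holds outside an event of `P₀ⁿ`-probability at most `C exp(-c n lam ε²)`. -/
def PosteriorTailBound {𝒳 : Type*} [MeasurableSpace 𝒳] {d : ℕ}
    (P₀ : Measure 𝒳) (π : Measure (EuclideanSpace ℝ (Fin d)))
    (p : EuclideanSpace ℝ (Fin d) → 𝒳 → ℝ) (θ₀ : EuclideanSpace ℝ (Fin d))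
    (lam : ℝ) (S : Set ℝ) : Prop :=
  ∃ c > 0, ∃ C > 0, ∀ n : ℕ, ∀ ε ∈ S,
    sampleLaw P₀ n {x | ENNReal.ofReal (C * Real.exp (-(c * n * lam * ε ^ 2))) <
        posterior π p x {θ | ε < ‖θ - θ₀‖}} ≤
      ENNReal.ofReal (C * Real.exp (-(c * n * lam * ε ^ 2)))

/-- `‖θ - θ₀‖ = O_p(r n)` when `X₁, …, Xₙ` are i.i.d. from `P₀` and, given them, `θ` is drawn from
the posterior: for every `δ > 0` there is `M` such that the joint probability of
`‖θ - θ₀‖ > M r n` is at most `δ` for all large `n`. -/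
def PosteriorBigOP {𝒳 : Type*} [MeasurableSpace 𝒳] {d : ℕ}
    (P₀ : Measure 𝒳) (π : Measure (EuclideanSpace ℝ (Fin d)))
    (p : EuclideanSpace ℝ (Fin d) → 𝒳 → ℝ) (θ₀ : EuclideanSpace ℝ (Fin d))
    (r : ℕ → ℝ) : Prop :=
  ∀ δ > 0, ∃ M > 0, ∀ᶠ n in atTop,
    ∫⁻ x, posterior π p x {θ | M * r n < ‖θ - θ₀‖} ∂(sampleLaw P₀ n) ≤ ENNReal.ofReal δ

end BerkCurvature

end

/-! By sufficiency on a finite sample space, the log-likelihood ratio of θ against θ₀ is n times a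
linear function of the empirical frequencies, whose mean is minus the divergence gap. The whole
proof therefore works on the event that every frequency is within κε of its mean; Hoeffding's
inequality bounds its complement by a constant times exp(-2κ²nε²).

On this event (`exists_logRatio_bounds`) the gap is comparable to ‖θ - θ₀‖² near θ₀, while the
fluctuation is at most a multiple of ε‖θ - θ₀‖, because log p is Lipschitz at θ₀. For small κ,
curvature wins as soon as ‖θ - θ₀‖ ≥ ε. Away from θ₀, separation gives a fixed gap, uniformly in θ
although log p may be unbounded (`exists_logRatio_far`).

In Bayes' formula the numerator is a Gaussian integral plus an exponentially small remainder, and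
the evidence is at least the contribution of a ball of radius ρε. For nε² ≥ 1 both the Gaussian
integral and the ball have order ε^d, so no polynomial factor survives in the ratio
(`exists_ratio_le`); for nε² < 1 the claim is trivial.

The constants may depend on the model, so the smallest eigenvalue enters only through its positivity
and is absorbed into c. The rate in probability comes from the radius at which the exponent equals
log n. -/

namespace BerkCurvature

/-! ### Calculus at a nondegenerate minimum -/

/-- Second-order Taylor expansion at a critical point. -/
theorem eventually_abs_taylor_two_le {E : Type*} [NormedAddCommGroup E] [NormedSpace ℝ E]
    {f : E → ℝ} {x : E} (hf : ContDiffAt ℝ 2 f x) (hx : fderiv ℝ f x = 0) {ε : ℝ} (hε : 0 < ε) :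
    ∀ᶠ y in 𝓝 x, |f y - f x - fderiv ℝ (fderiv ℝ f) x (y - x) (y - x) / 2| ≤ ε * ‖y - x‖ ^ 2 := by
  have h1 : DifferentiableAt ℝ (fderiv ℝ f) x :=
    (hf.fderiv_right (m := 1) (by norm_num)).differentiableAt (by norm_num)
  have h2 := (h1.hasFDerivAt.isLittleO).def hε
  have h3 : ∀ᶠ y in 𝓝 x, DifferentiableAt ℝ f y :=
    (hf.eventually (by simp)).mono fun y hy => hy.differentiableAt (by norm_num)
  obtain ⟨r, hr, hball⟩ := Metric.eventually_nhds_iff_ball.1 (h2.and h3)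
  filter_upwards [Metric.ball_mem_nhds x hr] with y hy
  set h := y - x with hh
  set B := fderiv ℝ (fderiv ℝ f) x
  have hmem : ∀ t ∈ Icc (0 : ℝ) 1, x + t • h ∈ Metric.ball x r := by
    intro t ht
    rw [mem_ball_iff_norm, add_sub_cancel_left, norm_smul, Real.norm_of_nonneg ht.1]
    rw [mem_ball_iff_norm, ← hh] at hy
    exact (mul_le_of_le_one_left (norm_nonneg _) ht.2).trans_lt hy
  -- Along the segment, subtract the quadratic term and apply the mean value inequality: the
  -- remaining derivative is small because `fderiv ℝ f` is differentiable at x and vanishes there.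
  have hderiv : ∀ t ∈ Icc (0 : ℝ) 1,
      HasDerivWithinAt (fun t : ℝ => f (x + t • h) - t ^ 2 / 2 * B h h)
        (fderiv ℝ f (x + t • h) h - t * B h h) (Icc 0 1) t := by
    intro t ht
    have e1 : HasDerivAt (fun t : ℝ => x + t • h) h t := by
      simpa using ((hasDerivAt_id t).smul_const h).const_add x
    have e2 := (hball _ (hmem t ht)).2.hasFDerivAt.comp_hasDerivAt t e1
    have e3 : HasDerivAt (fun t : ℝ => t ^ 2 / 2 * B h h) (t * B h h) t := by
      refine (((hasDerivAt_pow 2 t).div_const 2).mul_const (B h h)).congr_deriv ?_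
      norm_num
    exact (e2.sub e3).hasDerivWithinAt
  have hbound : ∀ t ∈ Ico (0 : ℝ) 1,
      ‖fderiv ℝ f (x + t • h) h - t * B h h‖ ≤ ε * ‖h‖ ^ 2 := by
    intro t ht
    have e1 := (hball _ (hmem t ⟨ht.1, ht.2.le⟩)).1
    rw [hx, sub_zero, add_sub_cancel_left] at e1
    have e2 : fderiv ℝ f (x + t • h) h - t * B h h
        = (fderiv ℝ f (x + t • h) - B (t • h)) h := by simp
    rw [e2]
    refine (ContinuousLinearMap.le_opNorm _ _).trans ?_
    calc _ ≤ ε * ‖t • h‖ * ‖h‖ := by gcongr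
      _ = t * (ε * ‖h‖ ^ 2) := by rw [norm_smul, Real.norm_of_nonneg ht.1]; ring
      _ ≤ _ := mul_le_of_le_one_left (by positivity) ht.2.le
  have := norm_image_sub_le_of_norm_deriv_le_segment_01' hderiv hbound
  rw [Real.norm_eq_abs] at this
  convert this using 2
  simp only [one_smul, zero_smul, add_zero, hh, add_sub_cancel]
  ring

/-- Two-sided quadratic bounds at a nondegenerate local minimum. -/
theorem exists_quadratic_bounds {E : Type*} [NormedAddCommGroup E] [NormedSpace ℝ E]
    [FiniteDimensional ℝ E] {f : E → ℝ} {x : E} (hf : ContDiffAt ℝ 2 f x) (hmin : IsLocalMin f x)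
    (hpos : ∀ v : E, v ≠ 0 → 0 < iteratedFDeriv ℝ 2 f x ![v, v]) :
    ∃ a > 0, ∃ b > 0, ∀ᶠ y in 𝓝 x,
      a * ‖y - x‖ ^ 2 ≤ f y - f x ∧ f y - f x ≤ b * ‖y - x‖ ^ 2 := by
  set B := fderiv ℝ (fderiv ℝ f) x with hB
  have hpos' : ∀ v ∈ Metric.sphere (0 : E) 1, 0 < B v v := by
    intro v hv
    have := hpos v (ne_zero_of_mem_unit_sphere ⟨v, hv⟩)
    rwa [iteratedFDeriv_two_apply] at this
  obtain ⟨m, hm, hm'⟩ := (isCompact_sphere (0 : E) 1).exists_forall_le'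
    (f := fun v => B v v) (by fun_prop) hpos'
  have hlow : ∀ v : E, m * ‖v‖ ^ 2 ≤ B v v := by
    intro v
    rcases eq_or_ne v 0 with rfl | hv
    · simp
    have hn : 0 < ‖v‖ := norm_pos_iff.2 hv
    have := hm' (‖v‖⁻¹ • v) (by simp [norm_smul, hn.ne'])
    simp only [map_smul, _root_.smul_apply, smul_eq_mul] at this
    rw [← mul_assoc, ← sq, inv_pow, ← div_eq_inv_mul, le_div_iff₀ (by positivity)] at this
    exact this
  -- The quadratic term is at least (m/2)‖y - x‖², and the Taylor error is allowed half of that.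
  refine ⟨m / 4, by positivity, ‖B‖ + m, by positivity, ?_⟩
  filter_upwards [eventually_abs_taylor_two_le hf hmin.fderiv_eq_zero
    (show 0 < m / 4 by positivity)] with y hy
  have h1 := hlow (y - x)
  have h2 : B (y - x) (y - x) ≤ ‖B‖ * ‖y - x‖ ^ 2 := by
    have := (le_abs_self _).trans (B.le_opNorm₂ (y - x) (y - x))
    rwa [mul_assoc, ← sq] at this
  have h3 : 0 ≤ ‖B‖ * ‖y - x‖ ^ 2 := by positivity
  have h4 : 0 ≤ m * ‖y - x‖ ^ 2 := by positivity
  rw [abs_le] at hy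
  constructor <;> nlinarith [hy.1, hy.2]

/-! ### Deterministic control of the log-likelihood ratio -/

/-- Average log-likelihood ratio against `q₀` for the empirical weights `w`. -/
noncomputable def logRatio {𝒳 : Type*} [Fintype 𝒳] (w q q₀ : 𝒳 → ℝ) : ℝ :=
  ∑ y, w y * (Real.log (q y) - Real.log (q₀ y))

theorem abs_logRatio_sub_le {𝒳 : Type*} [Fintype 𝒳] {w w' q q₀ : 𝒳 → ℝ} {t : ℝ}
    (hw : ∀ y, |w y - w' y| ≤ t) :
    |logRatio w q q₀ - logRatio w' q q₀| ≤ t * ∑ y, |Real.log (q y) - Real.log (q₀ y)| := by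
  rw [logRatio, logRatio, ← Finset.sum_sub_distrib, Finset.mul_sum]
  refine (Finset.abs_sum_le_sum_abs _ _).trans (Finset.sum_le_sum fun y _ => ?_)
  rw [← sub_mul, abs_mul]
  exact mul_le_mul_of_nonneg_right (hw y) (abs_nonneg _)

/-- Differentiability of log p at θ₀ makes the sampling fluctuation of the log-likelihood ratio
linear in ‖θ - θ₀‖, so that the quadratic gap can dominate it. -/
theorem exists_log_lipschitz {𝒳 : Type*} [Fintype 𝒳] {d : ℕ}
    {p : EuclideanSpace ℝ (Fin d) → 𝒳 → ℝ}
    {θ₀ : EuclideanSpace ℝ (Fin d)} (hp : ContDiffAt ℝ 2 p θ₀) (hpos : ∀ y, 0 < p θ₀ y) :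
    ∃ K > 0, ∀ᶠ θ in 𝓝 θ₀, ∑ y, |Real.log (p θ y) - Real.log (p θ₀ y)| ≤ K * ‖θ - θ₀‖ := by
  have h : (fun θ => ∑ y, |Real.log (p θ y) - Real.log (p θ₀ y)|) =O[𝓝 θ₀]
      (fun θ => θ - θ₀) := by
    refine Asymptotics.IsBigO.fun_sum
      (A := fun y θ => |Real.log (p θ y) - Real.log (p θ₀ y)|) fun y _ => ?_
    have hy : ContDiffAt ℝ 2 (fun θ => p θ y) θ₀ := contDiffAt_pi.1 hp y
    exact (((hy.log (hpos y).ne').differentiableAt (by norm_num)).isBigO_sub).abs_left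
  obtain ⟨K, hK, h⟩ := h.exists_pos
  refine ⟨K, hK, h.bound.mono fun θ hθ => ?_⟩
  exact (le_abs_self _).trans hθ

section KL

variable {𝒳 : Type*} [Fintype 𝒳] [MeasurableSpace 𝒳] {d : ℕ}

/-- The entropy of P cancels, leaving minus the `logRatio` with the true weights. -/
theorem kl_sub_kl (P : Measure 𝒳) {q q' : 𝒳 → ℝ} (hq : ∀ y, 0 < q y) (hq' : ∀ y, 0 < q' y) :
    kl P q - kl P q' = -∑ y, P.real {y} * (Real.log (q y) - Real.log (q' y)) := by
  rw [kl, kl, ← Finset.sum_sub_distrib, ← Finset.sum_neg_distrib]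
  refine Finset.sum_congr rfl fun y _ => ?_
  rcases eq_or_ne (P.real {y}) 0 with h | h
  · simp [h]
  rw [Real.log_div h (hq y).ne', Real.log_div h (hq' y).ne']
  ring

theorem contDiffAt_kl (P : Measure 𝒳) {p : EuclideanSpace ℝ (Fin d) → 𝒳 → ℝ}
    {θ₀ : EuclideanSpace ℝ (Fin d)} (hp : ContDiffAt ℝ 2 p θ₀) (hpos : ∀ y, 0 < p θ₀ y) :
    ContDiffAt ℝ 2 (fun θ => kl P (p θ)) θ₀ := by
  unfold kl
  refine ContDiffAt.sum fun y _ => ?_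
  rcases eq_or_ne (P.real {y}) 0 with h | h
  · simpa [h] using contDiffAt_const
  · have hy : ContDiffAt ℝ 2 (fun θ => p θ y) θ₀ := contDiffAt_pi.1 hp y
    exact contDiffAt_const.mul ((contDiffAt_const.div hy (hpos y).ne').log
      (div_ne_zero h (hpos y).ne'))

/-- A lower bound on the divergence gap gives an upper bound on the log-likelihood ratio, uniformly
over all empirical weights close to `P`. -/
theorem exists_logRatio_far (P : Measure 𝒳) {q₀ : 𝒳 → ℝ} (hq₀ : q₀ ∈ openSimplex 𝒳)
    {η : ℝ} (hη : 0 < η) :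
    ∃ t₀ > 0, ∀ w : 𝒳 → ℝ, (∀ y, 0 ≤ w y) → (∀ y, |w y - P.real {y}| ≤ t₀) →
      ∀ q ∈ openSimplex 𝒳, kl P q₀ + η ≤ kl P q → logRatio w q q₀ ≤ -(η / 2) := by
  have hlog : ∀ q ∈ openSimplex 𝒳, ∀ y, 0 ≤ -Real.log (q y) := fun q hq y => by
    have : q y ≤ 1 := hq.2 ▸ Finset.single_le_sum (fun z _ => (hq.1 z).le) (Finset.mem_univ y)
    linarith [Real.log_nonpos (hq.1 y).le this]
  set h₀ := ∑ y, P.real {y} * -Real.log (q₀ y) with hh₀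
  have h₀nn : 0 ≤ h₀ := Finset.sum_nonneg fun y _ => mul_nonneg measureReal_nonneg (hlog q₀ hq₀ y)
  set A := ∑ y, -Real.log (q₀ y) with hA
  have hAnn : 0 ≤ A := Finset.sum_nonneg fun y _ => hlog q₀ hq₀ y
  set τ := η / (4 * (h₀ + η)) with hτ
  have hτpos : 0 < τ := by positivity
  -- Since log q is unbounded over the simplex, additive closeness of w to P is not enough. Instead
  -- w ≥ (1 - τ)P, and -log q ≥ 0 gives a bound uniform in q. This costs η/4; the fixed q₀ costs
  -- another η/4 through t₀A.
  have hτe : τ * (h₀ + η) = η / 4 := by rw [hτ]; field_simp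
  have hτ1 : τ ≤ 1 := by
    rw [hτ, div_le_one (by positivity)]; linarith
  have hsmall : ∀ᶠ t in 𝓝[>] (0 : ℝ), t * A < η / 4 ∧
      ∀ y, P.real {y} ≠ 0 → t < τ * P.real {y} := by
    refine Filter.Eventually.filter_mono nhdsWithin_le_nhds ?_
    refine Filter.Eventually.and ?_ (eventually_all.2 fun y => ?_)
    · have : Tendsto (fun t : ℝ => t * A) (𝓝 0) (𝓝 (0 * A)) := tendsto_id.mul_const A
      rw [zero_mul] at this
      exact this.eventually_lt_const (by positivity)
    · by_cases hy : P.real {y} = 0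
      · simp [hy]
      · have : 0 < τ * P.real {y} :=
          mul_pos hτpos (lt_of_le_of_ne measureReal_nonneg (Ne.symm hy))
        filter_upwards [eventually_lt_nhds this] with t ht _ using ht
  obtain ⟨t₀, ⟨ht1, ht2⟩, ht0⟩ := (hsmall.and self_mem_nhdsWithin).exists
  refine ⟨t₀, ht0, fun w hw hwP q hq hgap => ?_⟩
  have hgap' : h₀ + η ≤ ∑ y, P.real {y} * -Real.log (q y) := by
    have := kl_sub_kl P hq.1 hq₀.1
    have e : (-∑ y, P.real {y} * (Real.log (q y) - Real.log (q₀ y)))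
        = (∑ y, P.real {y} * -Real.log (q y)) - h₀ := by
      rw [hh₀, ← Finset.sum_sub_distrib, ← Finset.sum_neg_distrib]
      exact Finset.sum_congr rfl fun y _ => by ring
    linarith
  have h1 : (1 - τ) * ∑ y, P.real {y} * -Real.log (q y) ≤ ∑ y, w y * -Real.log (q y) := by
    rw [Finset.mul_sum]
    refine Finset.sum_le_sum fun y _ => ?_
    rw [← mul_assoc]
    refine mul_le_mul_of_nonneg_right ?_ (hlog q hq y)
    by_cases hy : P.real {y} = 0
    · rw [hy, mul_zero]; exact hw y
    · have := ht2 y hy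
      have := (abs_le.1 (hwP y)).1
      linarith
  have h2 : ∑ y, w y * -Real.log (q₀ y) ≤ h₀ + t₀ * A := by
    rw [hh₀, hA, Finset.mul_sum, ← Finset.sum_add_distrib]
    refine Finset.sum_le_sum fun y _ => ?_
    rw [← add_mul]
    refine mul_le_mul_of_nonneg_right ?_ (hlog q₀ hq₀ y)
    linarith [(abs_le.1 (hwP y)).2]
  have h3 : logRatio w q q₀ = ∑ y, w y * -Real.log (q₀ y) - ∑ y, w y * -Real.log (q y) := by
    rw [logRatio, ← Finset.sum_sub_distrib]
    exact Finset.sum_congr rfl fun y _ => by ring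
  have h4 := mul_le_mul_of_nonneg_left hgap' (sub_nonneg.2 hτ1)
  rw [h3]
  linarith

/-- Uniform bounds on the log-likelihood ratio on the event that all empirical frequencies are
within `κ ε` of their means. -/
theorem exists_logRatio_bounds (P₀ : Measure 𝒳)
    {Θ : Set (EuclideanSpace ℝ (Fin d))} {p : EuclideanSpace ℝ (Fin d) → 𝒳 → ℝ}
    (hp : ∀ θ ∈ Θ, p θ ∈ openSimplex 𝒳) {θ₀ : EuclideanSpace ℝ (Fin d)}
    (hθ₀ : IsPseudoTrue P₀ p Θ θ₀) (hθ₀_int : θ₀ ∈ interior Θ) (hp_smooth : ContDiffAt ℝ 2 p θ₀)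
    (h_nondeg : ∀ v : EuclideanSpace ℝ (Fin d), v ≠ 0 →
      0 < iteratedFDeriv ℝ 2 (fun θ => kl P₀ (p θ)) θ₀ ![v, v]) {r₀ : ℝ} (hr₀ : 0 < r₀) :
    ∃ a > 0, ∃ η > 0, ∃ ρ > 0, ∃ κ > 0, ∃ r > 0, ∃ δ > 0, r ≤ r₀ ∧ Metric.ball θ₀ r ⊆ Θ ∧
      ρ * δ < r ∧ a / 4 * δ ^ 2 ≤ η / 2 ∧
      ∀ ε > 0, ε ≤ δ → ∀ w : 𝒳 → ℝ, (∀ y, 0 ≤ w y) → (∀ y, |w y - P₀.real {y}| ≤ κ * ε) →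
        (∀ θ, ε ≤ ‖θ - θ₀‖ → ‖θ - θ₀‖ < r → logRatio w (p θ) (p θ₀) ≤ -(a * ‖θ - θ₀‖ ^ 2)) ∧
        (∀ θ ∈ Θ, r ≤ ‖θ - θ₀‖ → logRatio w (p θ) (p θ₀) ≤ -η) ∧
        (∀ θ, ‖θ - θ₀‖ ≤ ρ * ε → -(a / 4 * ε ^ 2) ≤ logRatio w (p θ) (p θ₀)) := by
  have hq₀ := hp θ₀ hθ₀.1
  have hΘn : Θ ∈ 𝓝 θ₀ := mem_interior_iff_mem_nhds.1 hθ₀_int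
  obtain ⟨a, ha, b, hb, hab⟩ := exists_quadratic_bounds (contDiffAt_kl P₀ hp_smooth hq₀.1)
    (Filter.mem_of_superset hΘn hθ₀.2.1) h_nondeg
  obtain ⟨K, hK, hlip⟩ := exists_log_lipschitz hp_smooth hq₀.1
  obtain ⟨r₁, hr₁, hball⟩ := Metric.eventually_nhds_iff_ball.1 ((hab.and hlip).and hΘn)
  set r := min r₁ r₀ with hr
  have hrpos : 0 < r := lt_min hr₁ hr₀
  have hrball : Metric.ball θ₀ r ⊆ Metric.ball θ₀ r₁ := Metric.ball_subset_ball (min_le_left _ _)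
  obtain ⟨η, hη, hsep⟩ := hθ₀.2.2 r hrpos
  obtain ⟨t₀, ht₀, hfar⟩ := exists_logRatio_far P₀ hq₀ hη
  -- With this κ the fluctuation is at most (a/2)ε‖θ - θ₀‖, half the curvature term once ‖θ - θ₀‖ ≥
  -- ε.
  set κ := a / (2 * K) with hκ
  have hκpos : 0 < κ := by positivity
  have hκK : κ * K = a / 2 := by rw [hκ]; field_simp
  -- On the ball of radius ρε, the gap and the fluctuation each cost at most (a/16)ε². Their sum is
  -- a quarter of the returned constant a/2, times ε².
  set ρ := min (1 / 8) (a / (16 * b)) with hρ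
  have hρpos : 0 < ρ := lt_min (by norm_num) (by positivity)
  have hρ8 : ρ ≤ 1 / 8 := min_le_left _ _
  have hρb : b * ρ ≤ a / 16 := by
    calc b * ρ ≤ b * (a / (16 * b)) := by gcongr; exact min_le_right _ _
      _ = a / 16 := by field_simp
  have hsmall : ∀ᶠ δ in 𝓝[>] (0 : ℝ), κ * δ < t₀ ∧ ρ * δ < r ∧ a / 2 / 4 * δ ^ 2 < η / 2 / 2 := by
    refine Filter.Eventually.filter_mono nhdsWithin_le_nhds ?_
    have key : ∀ (f : ℝ → ℝ) (c : ℝ), Continuous f → f 0 < c → ∀ᶠ δ in 𝓝 (0 : ℝ), f δ < c :=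
      fun f c hf hc => (hf.tendsto 0).eventually_lt_const hc
    refine (key _ _ (by fun_prop) (by simpa)).and ((key _ _ (by fun_prop) (by simpa)).and
      (key _ _ (by fun_prop) (by simpa)))
  obtain ⟨δ, ⟨hδ1, hδ2, hδ3⟩, hδ0⟩ := (hsmall.and self_mem_nhdsWithin).exists
  refine ⟨a / 2, by positivity, η / 2, by positivity, ρ, hρpos, κ, hκpos, r, hrpos, δ, hδ0,
    min_le_right _ _, fun θ hθ => (hball θ (hrball hθ)).2, hδ2, hδ3.le,
    fun ε hε hεδ w hw hwP => ?_⟩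
  have hloc : ∀ θ, ‖θ - θ₀‖ < r →
      logRatio w (p θ) (p θ₀) ≤ -(a * ‖θ - θ₀‖ ^ 2) + a / 2 * ε * ‖θ - θ₀‖ ∧
      -(b * ‖θ - θ₀‖ ^ 2) - a / 2 * ε * ‖θ - θ₀‖ ≤ logRatio w (p θ) (p θ₀) := by
    intro θ hθ
    obtain ⟨⟨⟨hl, hu⟩, hK'⟩, hmem⟩ := hball θ (hrball (mem_ball_iff_norm.2 hθ))
    rw [kl_sub_kl P₀ (hp θ hmem).1 hq₀.1] at hl hu
    have h1 := abs_logRatio_sub_le (q := p θ) (q₀ := p θ₀) hwP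
    have h2 : κ * ε * ∑ y, |Real.log (p θ y) - Real.log (p θ₀ y)| ≤ a / 2 * ε * ‖θ - θ₀‖ := by
      calc _ ≤ κ * ε * (K * ‖θ - θ₀‖) := by gcongr
        _ = κ * K * ε * ‖θ - θ₀‖ := by ring
        _ = _ := by rw [hκK]
    have h3 := abs_le.1 (h1.trans h2)
    change _ ≤ -logRatio (fun y => P₀.real {y}) (p θ) (p θ₀) at hl
    change -logRatio (fun y => P₀.real {y}) (p θ) (p θ₀) ≤ _ at hu
    constructor <;> linarith [h3.1, h3.2]
  refine ⟨fun θ hθ1 hθ2 => ?_, fun θ hθ hθr => ?_, fun θ hθ => ?_⟩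
  · have := (hloc θ hθ2).1
    have : a / 2 * ε * ‖θ - θ₀‖ ≤ a / 2 * ‖θ - θ₀‖ * ‖θ - θ₀‖ := by gcongr
    nlinarith
  · exact hfar w hw (fun y => (hwP y).trans ((mul_le_mul_of_nonneg_left hεδ hκpos.le).trans
      hδ1.le)) _ (hp θ hθ) (hsep θ hθ hθr)
  · have hθr : ‖θ - θ₀‖ < r := (hθ.trans (mul_le_mul_of_nonneg_left hεδ hρpos.le)).trans_lt hδ2
    refine le_trans ?_ (hloc θ hθr).2
    have h1 : b * ‖θ - θ₀‖ ^ 2 ≤ a / 16 * ε ^ 2 := by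
      calc b * ‖θ - θ₀‖ ^ 2 ≤ b * (ρ * ε) ^ 2 := by gcongr
        _ = b * ρ * ρ * ε ^ 2 := by ring
        _ ≤ a / 16 * 1 * ε ^ 2 := by gcongr; linarith
        _ = _ := by ring
    have h2 : a / 2 * ε * ‖θ - θ₀‖ ≤ a / 16 * ε ^ 2 := by
      calc a / 2 * ε * ‖θ - θ₀‖ ≤ a / 2 * ε * (1 / 8 * ε) := by
            gcongr; exact hθ.trans (by gcongr)
        _ = _ := by ring
    linarith

end KL

/-! ### Empirical frequencies and concentration -/

/-- The empirical frequency of `y` in the sample `x`. -/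
noncomputable def empFreq {𝒳 : Type*} {n : ℕ} (x : Fin n → 𝒳) (y : 𝒳) : ℝ :=
  (∑ i, ({y} : Set 𝒳).indicator (fun _ => (1 : ℝ)) (x i)) / n

theorem empFreq_nonneg {𝒳 : Type*} {n : ℕ} (x : Fin n → 𝒳) (y : 𝒳) : 0 ≤ empFreq x y :=
  div_nonneg (Finset.sum_nonneg fun _ _ => Set.indicator_nonneg (fun _ _ => zero_le_one) _)
    n.cast_nonneg

section Sample

variable {𝒳 : Type*} [MeasurableSpace 𝒳]

instance (P₀ : Measure 𝒳) [IsProbabilityMeasure P₀] (n : ℕ) :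
    IsProbabilityMeasure (sampleLaw P₀ n) := by
  unfold sampleLaw; infer_instance

/-- One-sided Hoeffding bound for bounded functions of i.i.d. samples. -/
theorem sampleLaw_real_sum_ge_le (P₀ : Measure 𝒳) [IsProbabilityMeasure P₀] (n : ℕ)
    {f : 𝒳 → ℝ} (hf : Measurable f) {a : ℝ} (hfI : ∀ y, f y ∈ Icc a (a + 1)) {t : ℝ}
    (ht : 0 ≤ t) :
    (sampleLaw P₀ n).real {x | n * t ≤ ∑ i, (f (x i) - ∫ y, f y ∂P₀)} ≤
      Real.exp (-(2 * n * t ^ 2)) := by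
  set g : 𝒳 → ℝ := fun y => f y - ∫ y, f y ∂P₀ with hg
  have hgm : Measurable g := hf.sub_const _
  have hind : ProbabilityTheory.iIndepFun (fun (i : Fin n) (x : Fin n → 𝒳) => g (x i))
      (sampleLaw P₀ n) :=
    ProbabilityTheory.iIndepFun_pi (X := fun _ => g) fun _ => hgm.aemeasurable
  have hsub : ∀ i ∈ (Finset.univ : Finset (Fin n)),
      ProbabilityTheory.HasSubgaussianMGF (fun x : Fin n → 𝒳 => g (x i))
        ((‖(a + 1) - a‖₊ / 2) ^ 2) (sampleLaw P₀ n) := by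
    intro i _
    have h1 := ProbabilityTheory.hasSubgaussianMGF_of_mem_Icc (μ := P₀) hf.aemeasurable
      (Eventually.of_forall hfI)
    have hmp : MeasurePreserving (Function.eval i) (sampleLaw P₀ n) P₀ :=
      measurePreserving_eval (fun _ : Fin n => P₀) i
    rw [← hmp.map_eq] at h1
    have h2 := h1.of_map hmp.measurable.aemeasurable
    rw [hmp.map_eq] at h2
    exact h2
  have h := ProbabilityTheory.HasSubgaussianMGF.measure_sum_ge_le_of_iIndepFun hind hsub
    (ε := n * t) (by positivity)
  refine h.trans (Real.exp_le_exp.2 (le_of_eq ?_))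
  rcases Nat.eq_zero_or_pos n with rfl | hn
  · simp
  · have : (n : ℝ) ≠ 0 := by positivity
    simp
    field_simp

/-- Hoeffding for each point indicator and its negative, then a union bound over the 2|𝒳| one-sided
events. -/
theorem sampleLaw_empFreq_le [Fintype 𝒳] [MeasurableSingletonClass 𝒳] (P₀ : Measure 𝒳)
    [IsProbabilityMeasure P₀] {n : ℕ} (hn : 0 < n) {t : ℝ} (ht : 0 ≤ t) :
    sampleLaw P₀ n {x | ¬ ∀ y, |empFreq x y - P₀.real {y}| ≤ t} ≤
      ENNReal.ofReal (2 * Fintype.card 𝒳 * Real.exp (-(2 * n * t ^ 2))) := by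
  have hn' : (0 : ℝ) < n := by exact_mod_cast hn
  let f : 𝒳 → 𝒳 → ℝ := fun y => ({y} : Set 𝒳).indicator (fun _ => (1 : ℝ))
  have hfm : ∀ y, Measurable (f y) := fun y => measurable_const.indicator (measurableSet_singleton y)
  have hf01 : ∀ y z, 0 ≤ f y z ∧ f y z ≤ 1 := fun y z =>
    ⟨Set.indicator_nonneg (fun _ _ => zero_le_one) _,
      Set.indicator_le_self' (fun _ _ => zero_le_one) _⟩
  have hint : ∀ y, ∫ z, f y z ∂P₀ = P₀.real {y} := fun y => by
    simp [f, integral_indicator (measurableSet_singleton y), measureReal_def]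
  have hsum : ∀ (x : Fin n → 𝒳) y, ∑ i, (f y (x i) - P₀.real {y})
      = n * (empFreq x y - P₀.real {y}) := fun x y => by
    rw [Finset.sum_sub_distrib, empFreq, mul_sub, mul_div_cancel₀ _ hn'.ne']
    simp [f]
  let A : 𝒳 → Set (Fin n → 𝒳) := fun y => {x | n * t ≤ ∑ i, (f y (x i) - ∫ z, f y z ∂P₀)}
  let B : 𝒳 → Set (Fin n → 𝒳) := fun y => {x | n * t ≤ ∑ i, (-f y (x i) - ∫ z, -f y z ∂P₀)}
  have hsub : {x : Fin n → 𝒳 | ¬ ∀ y, |empFreq x y - P₀.real {y}| ≤ t} ⊆ ⋃ y, (A y ∪ B y) := by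
    intro x hx
    simp only [mem_ofPred_eq, not_forall, not_le] at hx
    obtain ⟨y, hy⟩ := hx
    refine mem_iUnion.2 ⟨y, ?_⟩
    rcases lt_abs.1 hy with h | h
    · left
      change n * t ≤ _
      rw [hint, hsum]
      gcongr
    · right
      change n * t ≤ _
      rw [integral_neg, hint]
      have : ∑ i, (-f y (x i) - -P₀.real {y}) = n * -(empFreq x y - P₀.real {y}) := by
        rw [mul_neg, ← hsum, ← Finset.sum_neg_distrib]
        exact Finset.sum_congr rfl fun i _ => by ring
      rw [this]
      gcongr
  have hA : ∀ y, (sampleLaw P₀ n).real (A y) ≤ Real.exp (-(2 * n * t ^ 2)) := fun y =>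
    sampleLaw_real_sum_ge_le P₀ n (hfm y) (a := 0) (fun z => by simpa using hf01 y z) ht
  have hB : ∀ y, (sampleLaw P₀ n).real (B y) ≤ Real.exp (-(2 * n * t ^ 2)) := fun y =>
    sampleLaw_real_sum_ge_le P₀ n (hfm y).neg (a := -1)
      (fun z => by simpa using (hf01 y z).symm) ht
  rw [← ENNReal.ofReal_toReal (measure_ne_top _ _)]
  refine ENNReal.ofReal_le_ofReal ?_
  change (sampleLaw P₀ n).real _ ≤ _
  calc _ ≤ (sampleLaw P₀ n).real (⋃ y, (A y ∪ B y)) := measureReal_mono hsub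
    _ ≤ ∑ y, (sampleLaw P₀ n).real (A y ∪ B y) := measureReal_iUnion_fintype_le _
    _ ≤ ∑ _y : 𝒳, 2 * Real.exp (-(2 * n * t ^ 2)) := Finset.sum_le_sum fun y _ =>
        (measureReal_union_le _ _).trans (by linarith [hA y, hB y])
    _ = _ := by simp; ring

end Sample

theorem mul_sum_empFreq_mul {𝒳 : Type*} [Fintype 𝒳] {n : ℕ} (hn : 0 < n) (x : Fin n → 𝒳)
    (g : 𝒳 → ℝ) : n * ∑ y, empFreq x y * g y = ∑ i, g (x i) := by
  classical
  have hn' : (n : ℝ) ≠ 0 := by exact_mod_cast hn.ne'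
  rw [Finset.mul_sum]
  have : ∀ y, n * (empFreq x y * g y) = ∑ i, if x i = y then g y else 0 := fun y => by
    rw [empFreq, ← mul_assoc, mul_div_cancel₀ _ hn', Finset.sum_mul]
    refine Finset.sum_congr rfl fun i _ => ?_
    simp [Set.indicator_apply]
  simp_rw [this]
  rw [Finset.sum_comm]
  simp

/-- The factor at θ₀ is free of θ and cancels in Bayes' formula, so the posterior depends on the
data only through `empFreq`. -/
theorem likelihood_eq_mul_exp {𝒳 : Type*} [Fintype 𝒳] {d n : ℕ} (hn : 0 < n)
    {p : EuclideanSpace ℝ (Fin d) → 𝒳 → ℝ} (x : Fin n → 𝒳) {θ θ₀ : EuclideanSpace ℝ (Fin d)}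
    (hθ : ∀ y, 0 < p θ y) (hθ₀ : ∀ y, 0 < p θ₀ y) :
    likelihood p x θ =
      likelihood p x θ₀ * Real.exp (n * logRatio (empFreq x) (p θ) (p θ₀)) := by
  rw [logRatio, mul_sum_empFreq_mul hn x (fun y => Real.log (p θ y) - Real.log (p θ₀ y)),
    Real.exp_sum, likelihood, likelihood, ← Finset.prod_mul_distrib]
  refine Finset.prod_congr rfl fun i _ => ?_
  rw [Real.exp_sub, Real.exp_log (hθ _), Real.exp_log (hθ₀ _), mul_div_cancel₀ _ (hθ₀ _).ne']

/-! ### Bayes' formula: numerator against evidence -/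

section Posterior

variable {d : ℕ}

/-- A prior with a positive continuous density near `θ₀` is comparable to Lebesgue measure there. -/
theorem HasPosContDensityNear.exists_bounds {π : Measure (EuclideanSpace ℝ (Fin d))}
    {θ₀ : EuclideanSpace ℝ (Fin d)} (hπ : HasPosContDensityNear π θ₀) :
    ∃ r₀ > 0, ∃ m > 0, ∃ M > 0, ∀ S ⊆ Metric.ball θ₀ r₀, MeasurableSet S →
      ENNReal.ofReal m * volume S ≤ π S ∧ π S ≤ ENNReal.ofReal M * volume S := by
  obtain ⟨U, hU, hθU, f, hf, hfpos, hπU⟩ := hπ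
  have h0 := hfpos θ₀ hθU
  have hc : Tendsto f (𝓝 θ₀) (𝓝 (f θ₀)) := hf.continuousAt (hU.mem_nhds hθU)
  have hev := ((hc.eventually_const_lt (half_lt_self h0)).and
    (hc.eventually_lt_const (show f θ₀ < 2 * f θ₀ by linarith))).and (hU.mem_nhds hθU)
  obtain ⟨r₀, hr₀, hball⟩ := Metric.eventually_nhds_iff_ball.1 hev
  refine ⟨r₀, hr₀, f θ₀ / 2, by positivity, 2 * f θ₀, by positivity, fun S hS hSm => ?_⟩
  have hSU : S ⊆ U := fun θ hθ => (hball θ (hS hθ)).2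
  have e : π S = ∫⁻ θ in S, ENNReal.ofReal (f θ) := by
    rw [← Measure.restrict_eq_self π hSU, hπU, withDensity_apply _ hSm,
      Measure.restrict_restrict hSm, inter_eq_left.2 hSU]
  rw [e, ← setLIntegral_const, ← setLIntegral_const]
  exact ⟨setLIntegral_mono' hSm fun θ hθ => ENNReal.ofReal_le_ofReal (hball θ (hS hθ)).1.1.le,
    setLIntegral_mono' hSm fun θ hθ => ENNReal.ofReal_le_ofReal (hball θ (hS hθ)).1.2.le⟩

/-- The exact integral has order n^(-d/2); as 1/n ≤ ε², it is traded for ε^d, which matches the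
volume of the ball bounding the evidence. -/
theorem lintegral_gaussian_le (θ₀ : EuclideanSpace ℝ (Fin d)) {a ε : ℝ} (ha : 0 < a) (hε : 0 < ε)
    {n : ℕ} (hn : 1 ≤ n * ε ^ 2) :
    ∫⁻ θ, ENNReal.ofReal (Real.exp (-(n * a / 2) * ‖θ - θ₀‖ ^ 2)) ≤
      ENNReal.ofReal ((2 * Real.pi / a) ^ (d / 2 : ℝ) * ε ^ d) := by
  have hn0 : (0 : ℝ) < n := by
    rcases Nat.eq_zero_or_pos n with rfl | h
    · norm_num at hn
    · exact_mod_cast h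
  have hb : 0 < n * a / 2 := by positivity
  rw [lintegral_sub_right_eq_self
    (fun θ => ENNReal.ofReal (Real.exp (-(n * a / 2) * ‖θ‖ ^ 2))) θ₀]
  have hI := GaussianFourier.integral_rexp_neg_mul_sq_norm (V := EuclideanSpace ℝ (Fin d)) hb
  have hne : ∫ v : EuclideanSpace ℝ (Fin d), Real.exp (-(n * a / 2) * ‖v‖ ^ 2) ≠ 0 := by
    rw [hI]; positivity
  rw [← ofReal_integral_eq_lintegral_ofReal (.of_integral_ne_zero hne)
    (Eventually.of_forall fun _ => (Real.exp_pos _).le), hI, finrank_euclideanSpace_fin]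
  refine ENNReal.ofReal_le_ofReal ?_
  calc (Real.pi / (n * a / 2)) ^ (d / 2 : ℝ)
      ≤ (2 * Real.pi / a * ε ^ 2) ^ (d / 2 : ℝ) := by
        refine Real.rpow_le_rpow (by positivity) ?_ (by positivity)
        rw [div_le_iff₀ hb]
        have : 2 * Real.pi / a * ε ^ 2 * (n * a / 2) = Real.pi * (n * ε ^ 2) := by field_simp
        rw [this]
        exact le_mul_of_one_le_right Real.pi_pos.le hn
    _ = _ := by
        rw [Real.mul_rpow (by positivity) (by positivity), ← Real.rpow_natCast ε 2,
          ← Real.rpow_mul hε.le, ← Real.rpow_natCast ε d]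
        congr 2
        push_cast
        ring

variable {𝒳 : Type*} {n : ℕ}

theorem posterior_apply (π : Measure (EuclideanSpace ℝ (Fin d)))
    (p : EuclideanSpace ℝ (Fin d) → 𝒳 → ℝ) (x : Fin n → 𝒳)
    {A : Set (EuclideanSpace ℝ (Fin d))} (hA : MeasurableSet A) :
    posterior π p x A = (∫⁻ θ, ENNReal.ofReal (likelihood p x θ) ∂π)⁻¹ *
      ∫⁻ θ in A, ENNReal.ofReal (likelihood p x θ) ∂π := by
  rw [posterior, Measure.smul_apply, withDensity_apply _ hA, smul_eq_mul]

/-- Only an inequality: if the evidence is 0 or ∞, the conventions of `ENNReal` give total mass 0.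
-/
theorem posterior_le_one (π : Measure (EuclideanSpace ℝ (Fin d)))
    (p : EuclideanSpace ℝ (Fin d) → 𝒳 → ℝ) (x : Fin n → 𝒳)
    (A : Set (EuclideanSpace ℝ (Fin d))) : posterior π p x A ≤ 1 := by
  refine (measure_mono (subset_univ A)).trans ?_
  rw [posterior_apply π p x MeasurableSet.univ, Measure.restrict_univ]
  exact ENNReal.inv_mul_le_one _

theorem posterior_absolutelyContinuous (π : Measure (EuclideanSpace ℝ (Fin d)))
    (p : EuclideanSpace ℝ (Fin d) → 𝒳 → ℝ) (x : Fin n → 𝒳) : posterior π p x ≪ π :=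
  (withDensity_absolutelyContinuous _ _).smul_left _

/-- Bayes' formula with an upper bound on the numerator and a lower bound on the evidence. -/
theorem posterior_le_of_logRatio_bounds {π : Measure (EuclideanSpace ℝ (Fin d))}
    [IsProbabilityMeasure π] {p : EuclideanSpace ℝ (Fin d) → 𝒳 → ℝ} {x : Fin n → 𝒳}
    {Θ : Set (EuclideanSpace ℝ (Fin d))} (hπΘ : π Θᶜ = 0) {θ₀ : EuclideanSpace ℝ (Fin d)}
    {Λ : EuclideanSpace ℝ (Fin d) → ℝ} {l a η ρ r m M ε : ℝ} (hl : 0 < l) (ha : 0 < a)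
    (hρ : 0 < ρ) (hm : 0 < m) (hM : 0 < M) (hε : 0 < ε) (hρr : ρ * ε < r)
    (hn : 1 ≤ n * ε ^ 2) (hrΘ : Metric.ball θ₀ r ⊆ Θ)
    (hL : ∀ θ ∈ Θ, likelihood p x θ = l * Real.exp (n * Λ θ))
    (hπ : ∀ S ⊆ Metric.ball θ₀ r, MeasurableSet S →
      ENNReal.ofReal m * volume S ≤ π S ∧ π S ≤ ENNReal.ofReal M * volume S)
    (hnear : ∀ θ, ε ≤ ‖θ - θ₀‖ → ‖θ - θ₀‖ < r → Λ θ ≤ -(a * ‖θ - θ₀‖ ^ 2))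
    (hfar : ∀ θ ∈ Θ, r ≤ ‖θ - θ₀‖ → Λ θ ≤ -η)
    (hin : ∀ θ, ‖θ - θ₀‖ ≤ ρ * ε → -(a / 4 * ε ^ 2) ≤ Λ θ) :
    posterior π p x {θ | ε < ‖θ - θ₀‖} ≤ ENNReal.ofReal
      ((M * Real.exp (-(n * a / 2 * ε ^ 2)) * ((2 * Real.pi / a) ^ (d / 2 : ℝ) * ε ^ d)
          + Real.exp (-(n * η))) /
        (m * Real.exp (-(n * a / 4 * ε ^ 2)) *
          ((ρ * ε) ^ d * volume.real (Metric.ball (0 : EuclideanSpace ℝ (Fin d)) 1)))) := by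
  set A := {θ | ε < ‖θ - θ₀‖} with hA
  have hAm : MeasurableSet A := measurableSet_lt measurable_const (by fun_prop)
  set B := Metric.ball θ₀ r with hB
  have hBm : MeasurableSet B := Metric.isOpen_ball.measurableSet
  have hΘae : ∀ᵐ θ ∂π, θ ∈ Θ := hπΘ
  have hpi : π.restrict B ≤ ENNReal.ofReal M • volume := by
    refine Measure.le_iff.2 fun S hS => ?_
    rw [Measure.restrict_apply hS, Measure.smul_apply, smul_eq_mul]
    exact ((hπ _ inter_subset_right (hS.inter hBm)).2).trans
      (mul_le_mul_right (measure_mono inter_subset_left) _)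
  -- Half of the exponent n·a·‖θ - θ₀‖² is spent on the factor exp(-(n·a/2)ε²); the other half is
  -- kept as an integrable Gaussian.
  have hNnear : ∫⁻ θ in A ∩ B, ENNReal.ofReal (likelihood p x θ) ∂π ≤
      ENNReal.ofReal (l * (M * Real.exp (-(n * a / 2 * ε ^ 2)) *
        ((2 * Real.pi / a) ^ (d / 2 : ℝ) * ε ^ d))) := by
    calc _ ≤ ∫⁻ θ in A ∩ B, ENNReal.ofReal (l * Real.exp (-(n * a / 2 * ε ^ 2))) *
          ENNReal.ofReal (Real.exp (-(n * a / 2) * ‖θ - θ₀‖ ^ 2)) ∂π := by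
          refine setLIntegral_mono' (hAm.inter hBm) fun θ hθ => ?_
          have hθA : ε < ‖θ - θ₀‖ := hθ.1
          rw [hL θ (hrΘ hθ.2), ← ENNReal.ofReal_mul (by positivity), mul_assoc, ← Real.exp_add]
          refine ENNReal.ofReal_le_ofReal ?_
          gcongr
          have h1 := mul_le_mul_of_nonneg_left
            (hnear θ hθA.le (mem_ball_iff_norm.1 hθ.2)) n.cast_nonneg (α := ℝ)
          have h2 : n * a / 2 * ε ^ 2 ≤ n * a / 2 * ‖θ - θ₀‖ ^ 2 := by gcongr
          linarith
      _ ≤ ∫⁻ θ, ENNReal.ofReal (l * Real.exp (-(n * a / 2 * ε ^ 2))) *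
          ENNReal.ofReal (Real.exp (-(n * a / 2) * ‖θ - θ₀‖ ^ 2)) ∂(ENNReal.ofReal M • volume) :=
          lintegral_mono' ((Measure.restrict_mono inter_subset_right le_rfl).trans hpi) le_rfl
      _ = ENNReal.ofReal M * (ENNReal.ofReal (l * Real.exp (-(n * a / 2 * ε ^ 2))) *
          ∫⁻ θ, ENNReal.ofReal (Real.exp (-(n * a / 2) * ‖θ - θ₀‖ ^ 2))) := by
          rw [lintegral_smul_measure, lintegral_const_mul _ (by fun_prop), smul_eq_mul]
      _ ≤ ENNReal.ofReal M * (ENNReal.ofReal (l * Real.exp (-(n * a / 2 * ε ^ 2))) *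
          ENNReal.ofReal ((2 * Real.pi / a) ^ (d / 2 : ℝ) * ε ^ d)) := by
          gcongr
          exact lintegral_gaussian_le θ₀ ha hε hn
      _ = _ := by
          rw [← ENNReal.ofReal_mul (by positivity), ← ENNReal.ofReal_mul (by positivity)]
          congr 1
          ring
  have hNfar : ∫⁻ θ in A \ B, ENNReal.ofReal (likelihood p x θ) ∂π ≤
      ENNReal.ofReal (l * Real.exp (-(n * η))) := by
    calc _ ≤ ∫⁻ θ in A \ B, ENNReal.ofReal (l * Real.exp (-(n * η))) ∂π := by
          refine lintegral_mono_ae ?_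
          filter_upwards [ae_restrict_mem (hAm.diff hBm), ae_restrict_of_ae hΘae] with θ hθ hθΘ
          rw [hL θ hθΘ]
          refine ENNReal.ofReal_le_ofReal ?_
          have hr : r ≤ ‖θ - θ₀‖ := by
            have := hθ.2
            rwa [hB, mem_ball_iff_norm, not_lt] at this
          gcongr
          have := mul_le_mul_of_nonneg_left (hfar θ hθΘ hr) n.cast_nonneg (α := ℝ)
          linarith
      _ ≤ _ := by
          rw [setLIntegral_const]
          exact mul_le_of_le_one_right' prob_le_one
  have hN := add_le_add hNnear hNfar
  rw [lintegral_inter_add_sdiff _ A hBm, ← ENNReal.ofReal_add (by positivity) (by positivity),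
    ← mul_add] at hN
  set S := Metric.closedBall θ₀ (ρ * ε) with hS
  have hSB : S ⊆ B := Metric.closedBall_subset_ball hρr
  have hSm : MeasurableSet S := Metric.isClosed_closedBall.measurableSet
  set v := volume.real (Metric.ball (0 : EuclideanSpace ℝ (Fin d)) 1) with hv
  have hvpos : 0 < v := ENNReal.toReal_pos
    (Metric.measure_ball_pos _ _ one_pos).ne' measure_ball_lt_top.ne
  have hvol : volume S = ENNReal.ofReal ((ρ * ε) ^ d * v) := by
    rw [hS, Measure.addHaar_closedBall _ _ (by positivity), finrank_euclideanSpace_fin,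
      ENNReal.ofReal_mul (by positivity), hv, ofReal_measureReal measure_ball_lt_top.ne]
  have hD : ENNReal.ofReal (l * (m * Real.exp (-(n * a / 4 * ε ^ 2)) * ((ρ * ε) ^ d * v))) ≤
      ∫⁻ θ, ENNReal.ofReal (likelihood p x θ) ∂π := by
    calc _ = ENNReal.ofReal (l * Real.exp (-(n * a / 4 * ε ^ 2))) *
          (ENNReal.ofReal m * volume S) := by
          rw [hvol, ← ENNReal.ofReal_mul (by positivity), ← ENNReal.ofReal_mul (by positivity)]
          congr 1
          ring
      _ ≤ ENNReal.ofReal (l * Real.exp (-(n * a / 4 * ε ^ 2))) * π S := by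
          gcongr
          exact (hπ S hSB hSm).1
      _ = ∫⁻ θ in S, ENNReal.ofReal (l * Real.exp (-(n * a / 4 * ε ^ 2))) ∂π := by
          rw [setLIntegral_const]
      _ ≤ ∫⁻ θ in S, ENNReal.ofReal (likelihood p x θ) ∂π := by
          refine setLIntegral_mono' hSm fun θ hθ => ?_
          rw [hL θ (hrΘ (hSB hθ))]
          refine ENNReal.ofReal_le_ofReal ?_
          gcongr
          have := mul_le_mul_of_nonneg_left (hin θ (mem_closedBall_iff_norm.1 hθ))
            n.cast_nonneg (α := ℝ)
          linarith
      _ ≤ _ := setLIntegral_le_lintegral _ _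
  rw [posterior_apply π p x hAm]
  refine (mul_le_mul' (ENNReal.inv_le_inv.2 hD) hN).trans (le_of_eq ?_)
  rw [← ENNReal.ofReal_inv_of_pos (by positivity), ← ENNReal.ofReal_mul (by positivity),
    ← div_eq_inv_mul, mul_div_mul_left _ _ hl.ne']

/-- The ratio of the numerator bound to the evidence bound decays exponentially. -/
theorem exists_ratio_le (d : ℕ) {a η ρ m M v G δ : ℝ} (ha : 0 < a) (hη : 0 < η) (hρ : 0 < ρ)
    (hm : 0 < m) (hM : 0 < M) (hv : 0 < v) (hG : 0 < G) (hδ : a / 4 * δ ^ 2 ≤ η / 2) :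
    ∃ C > 0, ∀ n : ℕ, ∀ ε > 0, ε ≤ δ → 1 ≤ n * ε ^ 2 →
      (M * Real.exp (-(n * a / 2 * ε ^ 2)) * (G * ε ^ d) + Real.exp (-(n * η))) /
        (m * Real.exp (-(n * a / 4 * ε ^ 2)) * ((ρ * ε) ^ d * v)) ≤
      C * Real.exp (-(a / 8 * n * ε ^ 2)) := by
  set K := m * ρ ^ d * v with hK
  have hKpos : 0 < K := by positivity
  set F : ℝ := d.factorial * (4 / η) ^ d with hF
  have hFpos : 0 < F := by positivity
  refine ⟨(M * G + F) / K, by positivity, fun n ε hε hεδ hn => ?_⟩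
  have hn1 : (1 : ℝ) ≤ n := by
    rcases Nat.eq_zero_or_pos n with rfl | h
    · norm_num at hn
    · exact_mod_cast h
  have hε2 : a / 4 * ε ^ 2 ≤ η / 2 := by
    refine le_trans ?_ hδ
    gcongr
  have hεn : 1 ≤ n * ε := by
    refine (one_le_sq_iff₀ (by positivity)).1 ?_
    calc (1 : ℝ) ≤ n * ε ^ 2 := hn
      _ ≤ n * (n * ε ^ 2) := le_mul_of_one_le_left (by positivity) hn1
      _ = _ := by ring
  have h1 : Real.exp (-(n * a / 2 * ε ^ 2)) ≤
      Real.exp (-(n * a / 4 * ε ^ 2)) * Real.exp (-(a / 8 * n * ε ^ 2)) := by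
    rw [← Real.exp_add, Real.exp_le_exp]
    have : 0 ≤ a * n * ε ^ 2 := by positivity
    linarith
  -- The far term lacks the factor ε^d. Since nε ≥ 1, one may insert (nε)^d, and a quarter of the
  -- exponent nη absorbs n^d. The other three quarters cover (a/4 + a/8)nε², by the choice of δ.
  have h2 : (n : ℝ) ^ d * Real.exp (-(n * η / 4)) ≤ F := by
    have := Real.pow_div_factorial_le_exp (x := n * η / 4) (by positivity) d
    rw [Real.exp_neg, ← div_eq_mul_inv, div_le_iff₀ (Real.exp_pos _)]
    calc (n : ℝ) ^ d = F * ((n * η / 4) ^ d / d.factorial) := by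
          have : (n : ℝ) = 4 / η * (n * η / 4) := by field_simp
          rw [hF]
          conv_lhs => rw [this, mul_pow]
          field_simp
      _ ≤ _ := by gcongr
  have h3 : Real.exp (-(n * η)) ≤ F * ε ^ d *
      (Real.exp (-(n * a / 4 * ε ^ 2)) * Real.exp (-(a / 8 * n * ε ^ 2))) := by
    have e : Real.exp (-(n * η)) ≤ Real.exp (-(n * η / 4)) *
        (Real.exp (-(n * a / 4 * ε ^ 2)) * Real.exp (-(a / 8 * n * ε ^ 2))) := by
      rw [← Real.exp_add, ← Real.exp_add, Real.exp_le_exp]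
      have := mul_le_mul_of_nonneg_left hε2 n.cast_nonneg (α := ℝ)
      linarith
    refine e.trans ?_
    gcongr
    calc Real.exp (-(n * η / 4)) ≤ (n * ε) ^ d * Real.exp (-(n * η / 4)) :=
          le_mul_of_one_le_left (Real.exp_pos _).le (one_le_pow₀ hεn)
      _ = (n : ℝ) ^ d * Real.exp (-(n * η / 4)) * ε ^ d := by rw [mul_pow]; ring
      _ ≤ F * ε ^ d := by gcongr
  rw [div_le_iff₀ (by positivity)]
  calc _ ≤ M * (Real.exp (-(n * a / 4 * ε ^ 2)) * Real.exp (-(a / 8 * n * ε ^ 2))) * (G * ε ^ d)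
        + F * ε ^ d * (Real.exp (-(n * a / 4 * ε ^ 2)) * Real.exp (-(a / 8 * n * ε ^ 2))) := by
        gcongr
    _ = _ := by
        rw [hK, mul_pow]
        field_simp

end Posterior

/-! ### Positivity of the information metric -/

theorem lambdaMin_infoHessian_pos {𝒳 : Type*} [Fintype 𝒳] [DecidableEq 𝒳] {d : ℕ} (hd : 0 < d)
    {q : 𝒳 → ℝ} (hq : ∀ y, 0 < q y) {V : Matrix 𝒳 (Fin d) ℝ} (hV : LinearIndependent ℝ V.col) :
    0 < lambdaMin (infoHessian q V) := by
  have : Nonempty (Fin d) := ⟨⟨0, hd⟩⟩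
  have hpd : (infoHessian q V).PosDef := by
    have h := (Matrix.PosDef.diagonal (d := fun y => 1 / q y)
      fun y => one_div_pos.2 (hq y)).conjTranspose_mul_mul_same
      (Matrix.mulVec_injective_iff.2 hV)
    rwa [Matrix.conjTranspose_eq_transpose_of_trivial] at h
  rw [lambdaMin, hpd.1.spectrum_real_eq_range_eigenvalues]
  obtain ⟨i, hi⟩ := (Set.range_nonempty hpd.1.eigenvalues).csInf_mem (Set.finite_range _)
  rw [← hi]
  exact hpd.eigenvalues_pos i

/-! ### Changing the rate and the range of radii -/

section Tail

variable {𝒳 : Type*} [MeasurableSpace 𝒳] {d : ℕ} {P₀ : Measure 𝒳}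
  {π : Measure (EuclideanSpace ℝ (Fin d))} {p : EuclideanSpace ℝ (Fin d) → 𝒳 → ℝ}
  {θ₀ : EuclideanSpace ℝ (Fin d)}

theorem PosteriorTailBound.of_rate_one {S : Set ℝ} (h : PosteriorTailBound P₀ π p θ₀ 1 S)
    {lam : ℝ} (hlam : 0 < lam) : PosteriorTailBound P₀ π p θ₀ lam S := by
  obtain ⟨c, hc, C, hC, h⟩ := h
  refine ⟨c / lam, by positivity, C, hC, fun n ε hε => ?_⟩
  have e : c / lam * n * lam * ε ^ 2 = c * n * 1 * ε ^ 2 := by field_simp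
  rw [e]
  exact h n ε hε

/-- The tail beyond ε lies in the tail beyond the smaller radius sε ≤ δ; the price is a factor s² in
c. -/
theorem PosteriorTailBound.extend {lam δ : ℝ} (hδ : 0 < δ)
    (h : PosteriorTailBound P₀ π p θ₀ lam (Ioc 0 δ)) (R : ℝ) :
    PosteriorTailBound P₀ π p θ₀ lam (Ioc 0 R) := by
  obtain ⟨c, hc, C, hC, h⟩ := h
  set s := min 1 (δ / (max R 1)) with hs
  have hR : 0 < max R 1 := lt_max_of_lt_right one_pos
  have hspos : 0 < s := lt_min one_pos (by positivity)
  refine ⟨c * s ^ 2, by positivity, C, hC, fun n ε hε => ?_⟩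
  have hsε : s * ε ≤ δ := by
    calc s * ε ≤ δ / max R 1 * max R 1 := by
          gcongr
          · exact hε.1.le
          · exact min_le_right _ _
          · exact hε.2.trans (le_max_left _ _)
      _ = δ := by field_simp
  have hsε' : s * ε ≤ ε := mul_le_of_le_one_left hε.1.le (min_le_left _ _)
  have e : c * s ^ 2 * n * lam * ε ^ 2 = c * n * lam * (s * ε) ^ 2 := by ring
  rw [e]
  refine le_trans (measure_mono fun x hx => ?_) (h n (s * ε) ⟨mul_pos hspos hε.1, hsε⟩)
  exact lt_of_lt_of_le hx (measure_mono fun θ hθ => hsε'.trans_lt hθ)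

/-- Beyond a radius enclosing Θ the posterior has no mass, so the constants for that radius serve
all ε. -/
theorem PosteriorTailBound.of_isBounded {Θ : Set (EuclideanSpace ℝ (Fin d))} {lam : ℝ}
    (h : ∀ R > 0, PosteriorTailBound P₀ π p θ₀ lam (Ioc 0 R)) (hΘ : Bornology.IsBounded Θ)
    (hπΘ : π Θᶜ = 0) : PosteriorTailBound P₀ π p θ₀ lam (Ioi 0) := by
  obtain ⟨R, hR, hsub⟩ := hΘ.subset_closedBall_lt 0 θ₀
  obtain ⟨c, hc, C, hC, h⟩ := h R hR
  refine ⟨c, hc, C, hC, fun n ε hε => ?_⟩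
  rcases le_or_gt ε R with hεR | hεR
  · exact h n ε ⟨hε, hεR⟩
  · have hz : ∀ x : Fin n → 𝒳, posterior π p x {θ | ε < ‖θ - θ₀‖} = 0 := fun x => by
      refine posterior_absolutelyContinuous π p x (measure_mono_null ?_ hπΘ)
      intro θ hθ hθΘ
      exact absurd (mem_closedBall_iff_norm.1 (hsub hθΘ)) (not_le.2 (hεR.trans hθ))
    simp [hz]

theorem posteriorTailBound_of_subsingleton [Subsingleton (EuclideanSpace ℝ (Fin d))] {lam : ℝ}
    {S : Set ℝ} (hS : S ⊆ Ioi 0) : PosteriorTailBound P₀ π p θ₀ lam S := by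
  refine ⟨1, one_pos, 1, one_pos, fun n ε hε => ?_⟩
  have hz : {θ | ε < ‖θ - θ₀‖} = ∅ := by
    ext θ
    have : (0 : ℝ) < ε := hS hε
    simp [Subsingleton.elim θ θ₀, this.le]
  simp [hz]

/-- Exponential tails imply the rate `√(log n / (n lam))` in probability. -/
theorem PosteriorTailBound.posteriorBigOP [IsProbabilityMeasure P₀] {lam : ℝ} (hlam : 0 < lam)
    (h : PosteriorTailBound P₀ π p θ₀ lam (Ioc 0 1)) :
    PosteriorBigOP P₀ π p θ₀ (fun n => Real.sqrt (Real.log n / (n * lam))) := by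
  obtain ⟨c, hc, C, hC, h⟩ := h
  intro δ hδ
  -- This makes the exponent exactly log n, so both the posterior bound and the bad event are at
  -- most C/n.
  set M := Real.sqrt (1 / c) with hM
  have hMpos : 0 < M := Real.sqrt_pos.2 (by positivity)
  refine ⟨M, hMpos, ?_⟩
  have hlim : Tendsto (fun n : ℕ => M * Real.sqrt (Real.log n / (n * lam))) atTop (𝓝 0) := by
    have h1 : Tendsto (fun n : ℕ => Real.log n / (n * lam)) atTop (𝓝 0) := by
      have := (Real.isLittleO_log_id_atTop.tendsto_div_nhds_zero.comp
        tendsto_natCast_atTop_atTop).div_const lam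
      rw [zero_div] at this
      refine this.congr fun n => ?_
      simp [div_div]
    have h2 := (h1.sqrt).const_mul M
    simpa using h2
  have hlim2 : Tendsto (fun n : ℕ => C * (n : ℝ)⁻¹) atTop (𝓝 0) := by
    simpa using (tendsto_inv_atTop_nhds_zero_nat (𝕜 := ℝ)).const_mul C
  filter_upwards [hlim.eventually_le_const one_pos,
    hlim2.eventually_le_const (show 0 < δ / 2 by positivity), eventually_ge_atTop 2]
    with n hn1 hn2 hn
  have hn' : (1 : ℝ) < n := by exact_mod_cast hn
  have hn0 : (0 : ℝ) < n := by linarith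
  have hlog := Real.log_pos hn'
  set ε := M * Real.sqrt (Real.log n / (n * lam)) with hε
  have hεpos : 0 < ε := mul_pos hMpos (Real.sqrt_pos.2 (by positivity))
  have he : c * n * lam * ε ^ 2 = Real.log n := by
    rw [hε, mul_pow, hM, Real.sq_sqrt (by positivity), Real.sq_sqrt (by positivity)]
    field_simp
  have hb := h n ε ⟨hεpos, hn1⟩
  rw [he, Real.exp_neg, Real.exp_log hn0] at hb
  set T := {x : Fin n → 𝒳 | ENNReal.ofReal (C * (n : ℝ)⁻¹) <
    posterior π p x {θ | ε < ‖θ - θ₀‖}} with hT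
  -- The bad event is not known to be measurable; its measurable hull has the same mass.
  have hbd : ∀ x : Fin n → 𝒳, posterior π p x {θ | ε < ‖θ - θ₀‖} ≤
      ENNReal.ofReal (C * (n : ℝ)⁻¹) + (toMeasurable (sampleLaw P₀ n) T).indicator 1 x := by
    intro x
    by_cases hx : x ∈ T
    · rw [indicator_of_mem (subset_toMeasurable _ _ hx)]
      exact (posterior_le_one π p x _).trans le_add_self
    · exact (not_lt.1 hx).trans le_self_add
  calc _ ≤ ∫⁻ x, (ENNReal.ofReal (C * (n : ℝ)⁻¹) +
        (toMeasurable (sampleLaw P₀ n) T).indicator 1 x) ∂(sampleLaw P₀ n) := lintegral_mono hbd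
    _ = ENNReal.ofReal (C * (n : ℝ)⁻¹) + sampleLaw P₀ n T := by
        rw [lintegral_add_left measurable_const, lintegral_const, measure_univ, mul_one,
          lintegral_indicator_one (measurableSet_toMeasurable _ _), measure_toMeasurable]
    _ ≤ ENNReal.ofReal (δ / 2) + ENNReal.ofReal (δ / 2) :=
        add_le_add (ENNReal.ofReal_le_ofReal hn2) (hb.trans (ENNReal.ofReal_le_ofReal hn2))
    _ = ENNReal.ofReal δ := by
        rw [← ENNReal.ofReal_add (by positivity) (by positivity), add_halves]

end Tail

/-! ### Assembly -/

/-- Exponential posterior tails at all small radii. -/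
theorem exists_posteriorTailBound {𝒳 : Type*} [Fintype 𝒳] [MeasurableSpace 𝒳]
    [MeasurableSingletonClass 𝒳] {d : ℕ} (P₀ : Measure 𝒳) [IsProbabilityMeasure P₀]
    {Θ : Set (EuclideanSpace ℝ (Fin d))} {p : EuclideanSpace ℝ (Fin d) → 𝒳 → ℝ}
    (hp : ∀ θ ∈ Θ, p θ ∈ openSimplex 𝒳) {θ₀ : EuclideanSpace ℝ (Fin d)}
    (hθ₀ : IsPseudoTrue P₀ p Θ θ₀) (hθ₀_int : θ₀ ∈ interior Θ) (hp_smooth : ContDiffAt ℝ 2 p θ₀)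
    (h_nondeg : ∀ v : EuclideanSpace ℝ (Fin d), v ≠ 0 →
      0 < iteratedFDeriv ℝ 2 (fun θ => kl P₀ (p θ)) θ₀ ![v, v])
    {π : Measure (EuclideanSpace ℝ (Fin d))} [IsProbabilityMeasure π]
    (hπΘ : π Θᶜ = 0) (hπ : HasPosContDensityNear π θ₀) :
    ∃ δ > 0, PosteriorTailBound P₀ π p θ₀ 1 (Ioc 0 δ) := by
  obtain ⟨r₀, hr₀, m, hm, M, hM, hmM⟩ := hπ.exists_bounds
  obtain ⟨a, ha, η, hη, ρ, hρ, κ, hκ, r, hr, δ, hδ, hrr₀, hrΘ, hρδ, haδ, hbounds⟩ :=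
    exists_logRatio_bounds P₀ hp hθ₀ hθ₀_int hp_smooth h_nondeg hr₀
  have hv : 0 < volume.real (Metric.ball (0 : EuclideanSpace ℝ (Fin d)) 1) :=
    ENNReal.toReal_pos (Metric.measure_ball_pos _ _ one_pos).ne' measure_ball_lt_top.ne
  have hG : 0 < (2 * Real.pi / a) ^ (d / 2 : ℝ) := by positivity
  obtain ⟨C, hC, hratio⟩ := exists_ratio_le d ha hη hρ hm hM hv hG haδ
  set c := min (a / 8) (2 * κ ^ 2) with hc
  have hcpos : 0 < c := lt_min (by positivity) (by positivity)
  -- The three summands serve the posterior ratio, the Hoeffding bound, and the range nε² < 1, where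
  -- exp(c) makes the bound at least 1.
  set C' := C + 2 * Fintype.card 𝒳 + Real.exp c with hC'
  have hC'pos : 0 < C' := by positivity
  refine ⟨δ, hδ, c, hcpos, C', hC'pos, fun n ε hε => ?_⟩
  rw [mul_one]
  rcases lt_or_ge (n * ε ^ 2) 1 with hn | hn
  · have h1 : 1 ≤ C' * Real.exp (-(c * n * ε ^ 2)) := by
      have : c * n * ε ^ 2 ≤ c := by
        rw [mul_assoc]
        exact mul_le_of_le_one_right hcpos.le hn.le
      calc (1 : ℝ) = Real.exp c * Real.exp (-c) := by rw [← Real.exp_add]; simp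
        _ ≤ C' * Real.exp (-(c * n * ε ^ 2)) := by
          gcongr
          rw [hC']
          have : (0 : ℝ) ≤ 2 * Fintype.card 𝒳 := by positivity
          linarith
    refine prob_le_one.trans ?_
    rwa [← ENNReal.ofReal_one, ENNReal.ofReal_le_ofReal_iff (by positivity)]
  have hn0 : 0 < n := by
    rcases Nat.eq_zero_or_pos n with rfl | h
    · norm_num at hn
    · exact h
  have hexp : ∀ b, c ≤ b → Real.exp (-(b * n * ε ^ 2)) ≤ Real.exp (-(c * n * ε ^ 2)) := by
    intro b hb
    gcongr
  have hsub : {x : Fin n → 𝒳 | ENNReal.ofReal (C' * Real.exp (-(c * n * ε ^ 2))) <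
      posterior π p x {θ | ε < ‖θ - θ₀‖}} ⊆
      {x | ¬ ∀ y, |empFreq x y - P₀.real {y}| ≤ κ * ε} := by
    intro x hx hgood
    rw [mem_ofPred_eq] at hx
    refine hx.not_ge ?_
    obtain ⟨hnear, hfar, hin⟩ := hbounds ε hε.1 hε.2 (empFreq x) (empFreq_nonneg x) hgood
    have hq₀ := (hp θ₀ hθ₀.1).1
    refine (posterior_le_of_logRatio_bounds hπΘ (Λ := fun θ => logRatio (empFreq x) (p θ) (p θ₀))
      (l := likelihood p x θ₀) (Finset.prod_pos fun i _ => hq₀ _) ha hρ hm hM hε.1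
      ((mul_le_mul_of_nonneg_left hε.2 hρ.le).trans_lt hρδ) hn hrΘ
      (fun θ hθ => likelihood_eq_mul_exp hn0 x (hp θ hθ).1 hq₀)
      (fun S hS => hmM S (hS.trans (Metric.ball_subset_ball hrr₀))) hnear hfar hin).trans ?_
    refine ENNReal.ofReal_le_ofReal ((hratio n ε hε.1 hε.2 hn).trans ?_)
    have h2 : C ≤ C' := by
      have : 0 ≤ 2 * (Fintype.card 𝒳 : ℝ) + Real.exp c := by positivity
      rw [hC']; linarith
    exact mul_le_mul h2 (hexp _ (min_le_left _ _)) (Real.exp_pos _).le hC'pos.le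
  refine (measure_mono hsub).trans ((sampleLaw_empFreq_le P₀ hn0
    (mul_pos hκ hε.1).le).trans (ENNReal.ofReal_le_ofReal ?_))
  have e : 2 * n * (κ * ε) ^ 2 = 2 * κ ^ 2 * n * ε ^ 2 := by ring
  rw [e]
  have h2 : 2 * (Fintype.card 𝒳 : ℝ) ≤ C' := by
    have : 0 ≤ C + Real.exp c := by positivity
    rw [hC']; linarith
  exact mul_le_mul h2 (hexp _ (min_le_right _ _)) (Real.exp_pos _).le hC'pos.le

end BerkCurvature

theorem mainTheorem6 {𝒳 : Type*} [Fintype 𝒳] [DecidableEq 𝒳] [MeasurableSpace 𝒳]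
    [MeasurableSingletonClass 𝒳] {d : ℕ}
    (P₀ : Measure 𝒳) [IsProbabilityMeasure P₀]
    (Θ : Set (EuclideanSpace ℝ (Fin d))) (hΘ : MeasurableSet Θ)
    (p : EuclideanSpace ℝ (Fin d) → 𝒳 → ℝ)
    (hp : ∀ θ ∈ Θ, p θ ∈ BerkCurvature.openSimplex 𝒳)
    (hp_cont : ContinuousOn p Θ)
    (θ₀ : EuclideanSpace ℝ (Fin d))
    (hθ₀ : BerkCurvature.IsPseudoTrue P₀ p Θ θ₀)
    (hθ₀_int : θ₀ ∈ interior Θ)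
    (hp_smooth : ContDiffAt ℝ 2 p θ₀)
    (h_nondeg : ∀ v : EuclideanSpace ℝ (Fin d), v ≠ 0 →
      0 < iteratedFDeriv ℝ 2 (fun θ => BerkCurvature.kl P₀ (p θ)) θ₀ ![v, v])
    (V : Matrix 𝒳 (Fin d) ℝ) (hV : BerkCurvature.IsTangentBasis p θ₀ V)
    (π : Measure (EuclideanSpace ℝ (Fin d))) [IsProbabilityMeasure π]
    (hπ_supp : π Θᶜ = 0) (hπ : BerkCurvature.HasPosContDensityNear π θ₀) :
    (∀ R > 0, BerkCurvature.PosteriorTailBound P₀ π p θ₀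
      (BerkCurvature.lambdaMin (BerkCurvature.infoHessian (p θ₀) V)) (Ioc 0 R)) ∧
    (Bornology.IsBounded Θ → BerkCurvature.PosteriorTailBound P₀ π p θ₀
      (BerkCurvature.lambdaMin (BerkCurvature.infoHessian (p θ₀) V)) (Ioi 0)) ∧
    BerkCurvature.PosteriorBigOP P₀ π p θ₀ (fun n => Real.sqrt (Real.log n /
      (n * BerkCurvature.lambdaMin (BerkCurvature.infoHessian (p θ₀) V)))) := by
  -- For d = 0 the spectrum is empty and `lambdaMin` is the default value 0, so positivity fails;
  -- but then θ = θ₀ and all tails are empty.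
  rcases Nat.eq_zero_or_pos d with rfl | hd
  · refine ⟨fun R _ => BerkCurvature.posteriorTailBound_of_subsingleton fun ε hε => hε.1,
      fun _ => BerkCurvature.posteriorTailBound_of_subsingleton le_rfl, fun δ _ => ⟨1, one_pos, ?_⟩⟩
    refine Eventually.of_forall fun n => ?_
    have hz : ∀ M : ℝ, {θ : EuclideanSpace ℝ (Fin 0) | √M < ‖θ - θ₀‖} = ∅ := fun M => by
      ext θ
      simp [Subsingleton.elim θ θ₀]
    simp only [one_mul, hz, measure_empty, lintegral_zero, zero_le]
  have hlam := BerkCurvature.lambdaMin_infoHessian_pos hd (hp θ₀ hθ₀.1).1 hV.1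
  obtain ⟨δ, hδ, h⟩ := BerkCurvature.exists_posteriorTailBound P₀ hp hθ₀ hθ₀_int hp_smooth
    h_nondeg hπ_supp hπ
  have hall : ∀ R > 0, BerkCurvature.PosteriorTailBound P₀ π p θ₀
      (BerkCurvature.lambdaMin (BerkCurvature.infoHessian (p θ₀) V)) (Ioc 0 R) :=
    fun R _ => (h.of_rate_one hlam).extend hδ R
  exact ⟨hall, fun hb => .of_isBounded hall hb hπ_supp, (hall 1 one_pos).posteriorBigOP hlam⟩
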